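/- Let $k$ be a field of characteristic zero. A (nonassociative) $k$-algebra is a $k$-vector space $A$ with a bilinear product $\cdot$; call it a Yagzhev algebra if for all $x,y\in A$ $$x\cdot(y\cdot y)=-(y\cdot y)\cdot x,\qquad (x\cdot y+y\cdot x)\cdot y=2\,(y\cdot y)\cdot x .$$ On such an algebra put $\phi(x,y,z)=x\cdot(y\cdot z+z\cdot y)-(y\cdot z+z\cdot y)\cdot x$. Then: 1. In every Yagzhev algebra, $\phi$ is totally commutative, i.e. invariant under all permutations of its three arguments. 2. $\phi$ satisfies no further identities: if a ternary nonassociative polynomial $p$ over $k$ (a $k$-linear combination of monomials in one ternary operation and countably many variables) vanishes identically for the operation $\phi$ in every Yagzhev algebra over $k$, then $p$ vanishes identically in every $k$-vector space with a totally commutative trilinear operation. 3. $\phi$ generates a free suboperad. Namely, let the operad of Yagzhev algebras have as its component with finite set of inputs $S$ the multilinear elements of the free Yagzhev algebra on $S$, with composition given by substitution. Then for every finite set $S$ the component with inputs $S$ of the suboperad generated by $\phi$ is identified, by evaluating trees at $\phi$, with that of the free operad generated by one totally commutative ternary operation, i.e. with the vector space having as a basis the rooted trees whose inner vertices have three unordered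 children and whose leaves are labelled bijectively by $S$. 4. Yagzhev's iterated identity is exactly the Engel property for $\phi$: for every $n\ge 0$ and all elements $x,y$ of a Yagzhev algebra, $$(\cdots((x\cdot(y\cdot y))\cdot(y\cdot y))\cdots)\cdot(y\cdot y)=0\iff \phi(\phi(\cdots\phi(\phi(x,y,y),y,y)\cdots),y,y)=0,$$ where on each side there are $n$ iterations. -/

import Mathlib

universe u v w

noncomputable section

/-! ### Binary operations satisfying Yagzhev's identities

A vector space with a bilinear binary operation is a Mathlib nonassociative algebra:
`[NonUnitalNonAssocRing A] [Module k A] [IsScalarTower k A A] [SMulCommClass k A A]`. -/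

/-- The two Yagzhev identities for a (nonassociative) product. -/
structure IsYagzhev (A : Type v) [NonUnitalNonAssocRing A] : Prop where
  mul_sq : ∀ x y : A, x * (y * y) = -((y * y) * x)
  anticomm_mul : ∀ x y : A, (x * y + y * x) * y = (2 : ℕ) • ((y * y) * x)

/-- The ternary operation `φ(x, y, z) = x (y z + z y) - (y z + z y) x`. -/
def yagzhevPhi {A : Type v} [NonUnitalNonAssocRing A] (x y z : A) : A :=
  x * (y * z + z * y) - (y * z + z * y) * x

/-- A ternary operation is totally commutative if its value does not change under any permutation
of its three arguments. -/
def TotallyCommutative {B : Type v} (op : B → B → B → B) : Prop :=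
  ∀ (σ : Equiv.Perm (Fin 3)) (a : Fin 3 → B), op (a (σ 0)) (a (σ 1)) (a (σ 2)) = op (a 0) (a 1) (a 2)

/-! ### Ternary terms and identities of ternary operations -/

/-- Formal terms (monomials) in one ternary operation symbol, with variables in `X`. -/
inductive TernaryTerm (X : Type v) : Type v
  | var (x : X) : TernaryTerm X
  | op (a b c : TernaryTerm X) : TernaryTerm X

namespace TernaryTerm

variable {X : Type v}

/-- The value of a term for a given ternary operation and given values of the variables. -/
def eval {B : Type w} (op : B → B → B → B) (a : X → B) : TernaryTerm X → B
  | var x => a x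
  | .op s t r => op (s.eval op a) (t.eval op a) (r.eval op a)

/-- The list of variables of a term, with repetitions. -/
def leaves : TernaryTerm X → List X
  | var x => [x]
  | .op s t r => s.leaves ++ t.leaves ++ r.leaves

/-- A term is multilinear in the variables `X` if each of them occurs in it exactly once. -/
def IsMultilinear (t : TernaryTerm X) : Prop :=
  t.leaves.Nodup ∧ ∀ x, x ∈ t.leaves

/-- Two terms are equal up to total commutativity: the congruence generated by transposing
neighbouring arguments. -/
inductive CommRel : TernaryTerm X → TernaryTerm X → Prop
  | swap₁₂ (a b c) : CommRel (.op a b c) (.op b a c)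
  | swap₂₃ (a b c) : CommRel (.op a b c) (.op a c b)
  | congr {a a' b b' c c'} :
      CommRel a a' → CommRel b b' → CommRel c c' → CommRel (.op a b c) (.op a' b' c')
  | refl (a) : CommRel a a
  | symm {a b} : CommRel a b → CommRel b a
  | trans {a b c} : CommRel a b → CommRel b c → CommRel a c

variable (X) in
/-- The setoid on multilinear terms given by equality up to total commutativity. -/
def multilinearSetoid : Setoid {t : TernaryTerm X // t.IsMultilinear} where
  r s t := CommRel s.1 t.1
  iseqv := ⟨fun s => .refl s.1, .symm, .trans⟩

end TernaryTerm

/-- The identity `p = 0` holds for the ternary operation `op` on the `k`-module `B`. Here `p` is a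
ternary nonassociative polynomial: a formal `k`-linear combination of ternary terms. -/
def SatisfiesTernaryIdentity {k : Type u} [Field k] {X : Type v} {B : Type w}
    [AddCommGroup B] [Module k B] (op : B → B → B → B) (p : TernaryTerm X →₀ k) : Prop :=
  ∀ a : X → B, (p.sum fun t c => c • t.eval op a) = 0

/-! ### The free operad on one totally commutative ternary operation

Operads are taken with operations indexed by finite sets `S` of inputs. -/

/-- Rooted trees with all inner vertices having three (unordered) children, and leaves labelled
bijectively by `S`. -/
def TernaryTree (S : Type v) : Type v :=
  Quotient (TernaryTerm.multilinearSetoid S)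

/-- The tree represented by a multilinear term. -/
def TernaryTree.mk {S : Type v} (t : TernaryTerm S) (ht : t.IsMultilinear) : TernaryTree S :=
  Quotient.mk (TernaryTerm.multilinearSetoid S) ⟨t, ht⟩

/-- The component with inputs `S` of the free symmetric `k`-linear operad generated by one totally
commutative ternary operation: the vector space with basis all tree monomials on `S`. -/
abbrev FreeCommTernaryOperad (k : Type u) [Field k] (S : Type v) : Type (max u v) :=
  TernaryTree S →₀ k

/-! ### The free algebra satisfying Yagzhev's identities -/

section FreeYagzhev

variable (k : Type u) [Field k] (X : Type v)

/-- The relation generating the congruence by which the free nonassociative algebra is divided. -/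
inductive FreeYagzhev.Rel :
    FreeNonUnitalNonAssocAlgebra k X → FreeNonUnitalNonAssocAlgebra k X → Prop
  | mul_sq (x y) : Rel (x * (y * y)) (-((y * y) * x))
  | anticomm_mul (x y) : Rel ((x * y + y * x) * y) ((2 : ℕ) • ((y * y) * x))
  | smul (c : k) {a b} : Rel a b → Rel (c • a) (c • b)
  | add_right {a b} (c) : Rel a b → Rel (a + c) (b + c)
  | mul_left (a) {b c} : Rel b c → Rel (a * b) (a * c)
  | mul_right {a b} (c) : Rel a b → Rel (a * c) (b * c)

/-- The free `k`-algebra on the set `X` among nonassociative `k`-algebras with Yagzhev's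
identities. -/
def FreeYagzhev : Type (max u v) := Quot (FreeYagzhev.Rel k X)

namespace FreeYagzhev

variable {k X}

theorem Rel.add_left (a : FreeNonUnitalNonAssocAlgebra k X) {b c} (h : Rel k X b c) :
    Rel k X (a + b) (a + c) := by
  rw [add_comm _ b, add_comm _ c]; exact h.add_right _

theorem Rel.neg {a b} (h : Rel k X a b) : Rel k X (-a) (-b) := by
  simpa only [neg_one_smul] using h.smul (-1)

theorem Rel.sub_left (a : FreeNonUnitalNonAssocAlgebra k X) {b c} (h : Rel k X b c) :
    Rel k X (a - b) (a - c) := by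
  simpa only [sub_eq_add_neg] using h.neg.add_left a

theorem Rel.sub_right {a b} (c : FreeNonUnitalNonAssocAlgebra k X) (h : Rel k X a b) :
    Rel k X (a - c) (b - c) := by
  simpa only [sub_eq_add_neg] using h.add_right (-c)

theorem Rel.nsmul (n : ℕ) {a b} (h : Rel k X a b) : Rel k X (n • a) (n • b) := by
  simpa only [Nat.cast_smul_eq_nsmul] using h.smul (n : k)

theorem Rel.zsmul (n : ℤ) {a b} (h : Rel k X a b) : Rel k X (n • a) (n • b) := by
  simpa only [Int.cast_smul_eq_zsmul] using h.smul (n : k)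

instance : Zero (FreeYagzhev k X) := ⟨Quot.mk _ 0⟩

instance : Add (FreeYagzhev k X) :=
  ⟨Quot.map₂ (· + ·) (fun _ _ _ => Rel.add_left _) fun _ _ _ => Rel.add_right _⟩

instance : Neg (FreeYagzhev k X) := ⟨Quot.map Neg.neg fun _ _ => Rel.neg⟩

instance : Sub (FreeYagzhev k X) :=
  ⟨Quot.map₂ Sub.sub (fun _ _ _ => Rel.sub_left _) fun _ _ _ => Rel.sub_right _⟩

instance : Mul (FreeYagzhev k X) :=
  ⟨Quot.map₂ (· * ·) (fun _ _ _ => Rel.mul_left _) fun _ _ _ => Rel.mul_right _⟩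

instance : SMul ℕ (FreeYagzhev k X) := ⟨fun n => Quot.map (n • ·) fun _ _ => Rel.nsmul n⟩

instance : SMul ℤ (FreeYagzhev k X) := ⟨fun n => Quot.map (n • ·) fun _ _ => Rel.zsmul n⟩

instance : SMul k (FreeYagzhev k X) := ⟨fun c => Quot.map (c • ·) fun _ _ => Rel.smul c⟩

instance : NonUnitalNonAssocRing (FreeYagzhev k X) :=
  Function.Surjective.nonUnitalNonAssocRing (Quot.mk _) Quot.mk_surjective rfl
    (fun _ _ => rfl) (fun _ _ => rfl) (fun _ => rfl) (fun _ _ => rfl) (fun _ _ => rfl)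
    fun _ _ => rfl

instance : Module k (FreeYagzhev k X) :=
  Function.Surjective.module k ⟨⟨Quot.mk (Rel k X), rfl⟩, fun _ _ => rfl⟩ Quot.mk_surjective
    fun _ _ => rfl

instance : IsScalarTower k (FreeYagzhev k X) (FreeYagzhev k X) where
  smul_assoc := by
    rintro c ⟨a⟩ ⟨b⟩
    exact congrArg (Quot.mk _) (smul_mul_assoc c a b)

instance : SMulCommClass k (FreeYagzhev k X) (FreeYagzhev k X) where
  smul_comm := by
    rintro c ⟨a⟩ ⟨b⟩
    exact congrArg (Quot.mk _) (mul_smul_comm c a b).symm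

theorem isYagzhev : IsYagzhev (FreeYagzhev k X) where
  mul_sq := by rintro ⟨x⟩ ⟨y⟩; exact Quot.sound (Rel.mul_sq x y)
  anticomm_mul := by rintro ⟨x⟩ ⟨y⟩; exact Quot.sound (Rel.anticomm_mul x y)

variable (k) in
/-- The generators. -/
def of (x : X) : FreeYagzhev k X := Quot.mk _ (FreeNonUnitalNonAssocAlgebra.of k x)

section lift

variable {A : Type w} [NonUnitalNonAssocRing A] [Module k A] [IsScalarTower k A A]
  [SMulCommClass k A A]

theorem lift_rel (hA : IsYagzhev A) (f : X → A) {a b} (h : Rel k X a b) :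
    FreeNonUnitalNonAssocAlgebra.lift k f a = FreeNonUnitalNonAssocAlgebra.lift k f b := by
  induction h with
  | mul_sq x y => simp only [map_mul, map_neg, hA.mul_sq]
  | anticomm_mul x y => simp only [map_mul, map_add, map_nsmul, hA.anticomm_mul]
  | smul c _ h => simp only [map_smul, h]
  | add_right c _ h => simp only [map_add, h]
  | mul_left a _ h => simp only [map_mul, h]
  | mul_right c _ h => simp only [map_mul, h]

/-- The algebra homomorphism to an algebra with Yagzhev's identities which is determined by the
images of the generators. -/
def lift (hA : IsYagzhev A) (f : X → A) : FreeYagzhev k X →ₙₐ[k] A where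
  toFun := Quot.lift (FreeNonUnitalNonAssocAlgebra.lift k f) fun _ _ => lift_rel hA f
  map_smul' := by rintro c ⟨a⟩; exact map_smul (FreeNonUnitalNonAssocAlgebra.lift k f) c a
  map_zero' := map_zero (FreeNonUnitalNonAssocAlgebra.lift k f)
  map_add' := by rintro ⟨a⟩ ⟨b⟩; exact map_add (FreeNonUnitalNonAssocAlgebra.lift k f) a b
  map_mul' := by rintro ⟨a⟩ ⟨b⟩; exact map_mul (FreeNonUnitalNonAssocAlgebra.lift k f) a b

@[simp]
theorem lift_of (hA : IsYagzhev A) (f : X → A) (x : X) : lift hA f (of k x) = f x :=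
  FreeNonUnitalNonAssocAlgebra.lift_of_apply k f x

theorem lift_unique (hA : IsYagzhev A) (g : FreeYagzhev k X →ₙₐ[k] A) (f : X → A)
    (h : ∀ x, g (of k x) = f x) : g = lift hA f := by
  let q : FreeNonUnitalNonAssocAlgebra k X →ₙₐ[k] FreeYagzhev k X :=
    { toFun := Quot.mk _
      map_smul' := fun _ _ => rfl
      map_zero' := rfl
      map_add' := fun _ _ => rfl
      map_mul' := fun _ _ => rfl }
  have key : g.comp q = (lift hA f).comp q := by
    refine FreeNonUnitalNonAssocAlgebra.hom_ext k fun x => ?_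
    exact (h x).trans (lift_of hA f x).symm
  ext ⟨a⟩
  exact DFunLike.congr_fun key a

end lift

/-- Substitution: the algebra homomorphism replacing each generator `x` by `f x`. -/
def subst {Y : Type w} (f : X → FreeYagzhev k Y) : FreeYagzhev k X →ₙₐ[k] FreeYagzhev k Y :=
  lift isYagzhev f

end FreeYagzhev

end FreeYagzhev

/-! ### The suboperad generated by `φ`

The operad of algebras with Yagzhev's identities (over a field of characteristic zero) has as its
component with inputs `S` the multilinear elements of the free algebra on `S`; the identity
operation is the generator of the free algebra on one element, bijections of input sets act by
renaming generators, and the composition of `p` with operations `q s`, one for each input `s` of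
`p`, is the substitution of `q s` for `s`, the inputs of the different `q s` being kept disjoint. -/

/-- Membership in the suboperad generated by `φ`: the smallest family of subspaces which contains
the identity operation and `φ` and is closed under renaming of inputs and composition. -/
inductive IsPhiOperation (k : Type u) [Field k] : ∀ S : Type, FreeYagzhev k S → Prop
  | id : IsPhiOperation k Unit (FreeYagzhev.of k ())
  | phi : IsPhiOperation k (Fin 3)
      (yagzhevPhi (FreeYagzhev.of k 0) (FreeYagzhev.of k 1) (FreeYagzhev.of k 2))
  | rename {S T : Type} (e : S ≃ T) (p) :
      IsPhiOperation k S p → IsPhiOperation k T (FreeYagzhev.subst (fun s => .of k (e s)) p)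
  | comp {S : Type} [Finite S] {F : S → Type} [∀ s, Finite (F s)] (p) (q : ∀ s, FreeYagzhev k (F s)) :
      IsPhiOperation k S p → (∀ s, IsPhiOperation k (F s) (q s)) →
        IsPhiOperation k (Σ s, F s)
          (FreeYagzhev.subst (fun s => FreeYagzhev.subst (fun i => .of k ⟨s, i⟩) (q s)) p)
  | zero {S : Type} : IsPhiOperation k S 0
  | add {S : Type} (p q) :
      IsPhiOperation k S p → IsPhiOperation k S q → IsPhiOperation k S (p + q)
  | smul {S : Type} (c : k) (p) : IsPhiOperation k S p → IsPhiOperation k S (c • p)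

/-- The component with inputs `S` of the suboperad generated by `φ`. -/
def phiSuboperad (k : Type u) [Field k] (S : Type) : Submodule k (FreeYagzhev k S) where
  carrier := {p | IsPhiOperation k S p}
  zero_mem' := .zero
  add_mem' := fun hp hq => .add _ _ hp hq
  smul_mem' := fun c _ hp => .smul c _ hp

end

/-! Write `x ∘ y = xy + yx`. Polarising the first identity gives `φ(x, y, z) = -2 (y ∘ z) x`;
polarising the second relates the three products `(x ∘ y) z`, `(x ∘ z) y`, `(y ∘ z) x`, and dividing
by 3 makes them equal, so `φ` is symmetric. Since `φ(x, y, y) = 4 x (y y)`, the two iterated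
expressions differ by the nonzero factor `4 ^ n`.

Freeness rests on one construction: every totally commutative trilinear `ψ` on `B` is the
restriction of `φ` from a Yagzhev algebra on `B × End B` (`YagzhevEnvelope.isYagzhev`,
`YagzhevEnvelope.phi_inl`). For `B` the free totally commutative ternary algebra, a term evaluated
with `φ` at the generators becomes the basis vector of its class (`eval_phi_freeTernaryOp`). An
identity of `φ` therefore has zero coefficient sum on each class, and different trees have linearly
independent values.

That the trees span the suboperad is a matter of keeping track of variables: substituting
multilinear terms with disjoint variables into a multilinear term gives multilinear terms, and every
multilinear term arises from `φ` by composition and renaming. -/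

namespace IsYagzhev

/-! ### Polarised Yagzhev identities -/

variable {A : Type v} [NonUnitalNonAssocRing A]

theorem mul_anticomm (hA : IsYagzhev A) (x y z : A) :
    x * (y * z + z * y) = -((y * z + z * y) * x) := by
  have h := hA.mul_sq x (y + z)
  have hy := hA.mul_sq x y
  have hz := hA.mul_sq x z
  have e : (y + z) * (y + z) = y * y + (y * z + z * y) + z * z := by
    simp only [mul_add, add_mul]; abel
  rw [e, mul_add, mul_add, add_mul, add_mul, hy, hz] at h
  calc x * (y * z + z * y)
      = (-(y * y * x) + x * (y * z + z * y) + -(z * z * x)) + (y * y * x + z * z * x) := by abel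
    _ = _ := by rw [h]; abel

theorem phi_eq_neg (hA : IsYagzhev A) (x y z : A) :
    yagzhevPhi x y z = (-2 : ℤ) • ((y * z + z * y) * x) := by
  rw [yagzhevPhi, hA.mul_anticomm]; abel

theorem phi_self (hA : IsYagzhev A) (x y : A) :
    yagzhevPhi x y y = (4 : ℕ) • (x * (y * y)) := by
  have h : (y * y) * x = -(x * (y * y)) := by rw [hA.mul_sq, neg_neg]
  rw [yagzhevPhi, mul_add, add_mul, h]; abel

theorem anticomm_mul_linearized (hA : IsYagzhev A) (x y z : A) :
    (x * y + y * x) * z + (x * z + z * x) * y = (2 : ℕ) • ((y * z + z * y) * x) := by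
  have h := hA.anticomm_mul x (y + z)
  have hy := hA.anticomm_mul x y
  have hz := hA.anticomm_mul x z
  have e : (x * (y + z) + (y + z) * x) * (y + z) = (x * y + y * x) * y + (x * z + z * x) * z +
      ((x * y + y * x) * z + (x * z + z * x) * y) := by
    simp only [mul_add, add_mul]; abel
  have e' : (2 : ℕ) • ((y + z) * (y + z) * x) = (2 : ℕ) • ((y * y) * x) + (2 : ℕ) • ((z * z) * x) +
      (2 : ℕ) • ((y * z + z * y) * x) := by
    simp only [mul_add, add_mul, smul_add]; abel
  rw [e, e', hy, hz] at h
  exact add_left_cancel h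

theorem phi_swap_right (x y z : A) : yagzhevPhi x y z = yagzhevPhi x z y := by
  rw [yagzhevPhi, yagzhevPhi, add_comm (y * z)]

/-- The polarised second identity makes `φ` symmetric in its first two arguments. -/
theorem phi_swap_left (k : Type u) [Field k] [CharZero k] [Module k A] (hA : IsYagzhev A)
    (x y z : A) : yagzhevPhi x y z = yagzhevPhi y x z := by
  have h₁ := hA.anticomm_mul_linearized x y z
  have h₂ := hA.anticomm_mul_linearized y x z
  rw [hA.phi_eq_neg, hA.phi_eq_neg]
  rw [add_comm (y * x)] at h₂
  generalize (x * y + y * x) * z = a at *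
  generalize (x * z + z * x) * y = b at *
  generalize (y * z + z * y) * x = c at *
  -- The relations are `a + b = 2c` and, with `x` and `y` exchanged, `a + c = 2b`; their difference
  -- is `3 (b - c) = 0`.
  have h : (3 : k) • (b - c) = 0 := by
    have : (3 : k) • (b - c) = (3 : ℕ) • (b - c) := by
      rw [← Nat.cast_smul_eq_nsmul k]; norm_cast
    rw [this]
    have e : (3 : ℕ) • (b - c) = (a + b - (2 : ℕ) • c) - (a + c - (2 : ℕ) • b) := by abel
    rw [e, h₁, h₂]; abel
  have h := (smul_eq_zero.1 h).resolve_left three_ne_zero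
  rw [sub_eq_zero.1 h]

end IsYagzhev

/-! ### Total commutativity and the Engel property -/

theorem totallyCommutative_of_swap {B : Type v} {op : B → B → B → B}
    (h₁ : ∀ a b c, op a b c = op b a c) (h₂ : ∀ a b c, op a b c = op a c b) :
    TotallyCommutative op := by
  intro σ a
  have h01 : σ 0 ≠ σ 1 := σ.injective.ne (by decide)
  have h02 : σ 0 ≠ σ 2 := σ.injective.ne (by decide)
  have h12 : σ 1 ≠ σ 2 := σ.injective.ne (by decide)
  generalize σ 0 = i at *
  generalize σ 1 = j at *
  generalize σ 2 = l at *
  fin_cases i <;> fin_cases j <;> fin_cases l <;> simp at h01 h02 h12 ⊢ <;> grind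

namespace TotallyCommutative

variable {B : Type v} {op : B → B → B → B}

theorem swap_left (h : TotallyCommutative op) (a b c : B) : op a b c = op b a c := by
  simpa [Equiv.swap_apply_of_ne_of_ne] using (h (Equiv.swap 0 1) ![a, b, c]).symm

theorem swap_right (h : TotallyCommutative op) (a b c : B) : op a b c = op a c b := by
  simpa [Equiv.swap_apply_of_ne_of_ne] using (h (Equiv.swap 1 2) ![a, b, c]).symm

theorem eval_eq_of_commRel {X : Type w} (h : TotallyCommutative op) (a : X → B)
    {s t : TernaryTerm X} (hst : TernaryTerm.CommRel s t) : s.eval op a = t.eval op a := by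
  induction hst with
  | swap₁₂ => exact h.swap_left _ _ _
  | swap₂₃ => exact h.swap_right _ _ _
  | congr _ _ _ h₁ h₂ h₃ => simp only [TernaryTerm.eval, h₁, h₂, h₃]
  | refl => rfl
  | symm _ h => exact h.symm
  | trans _ _ h₁ h₂ => exact h₁.trans h₂

end TotallyCommutative

theorem IsYagzhev.totallyCommutative_phi (k : Type u) [Field k] [CharZero k] {A : Type v}
    [NonUnitalNonAssocRing A] [Module k A] (hA : IsYagzhev A) :
    TotallyCommutative (yagzhevPhi : A → A → A → A) :=
  totallyCommutative_of_swap (hA.phi_swap_left k) phi_swap_right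

theorem IsYagzhev.iterate_mul_sq_eq_zero_iff (k : Type u) [Field k] [CharZero k] {A : Type v}
    [NonUnitalNonAssocRing A] [Module k A] [IsScalarTower k A A] (hA : IsYagzhev A)
    (n : ℕ) (x y : A) :
    (fun z => z * (y * y))^[n] x = 0 ↔ (fun z => yagzhevPhi z y y)^[n] x = 0 := by
  have h : ∀ n, (fun z => yagzhevPhi z y y)^[n] x = (4 : k) ^ n • (fun z => z * (y * y))^[n] x := by
    intro n
    induction n with
    | zero => simp
    | succ n ih =>
      rw [Function.iterate_succ_apply', Function.iterate_succ_apply', ih, hA.phi_self,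
        smul_mul_assoc, ← Nat.cast_smul_eq_nsmul k, smul_smul, pow_succ']
      norm_cast
  rw [h, smul_eq_zero_iff_right (pow_ne_zero n (OfNat.ofNat_ne_zero 4))]

/-! ### Embedding a totally commutative ternary algebra into a Yagzhev algebra -/

section Envelope

variable {k : Type u} [Field k] {B : Type v} [AddCommGroup B] [Module k B]

/-- The space `B × End B`, on which a trilinear operation `ψ` of `B` defines the product
`(x, T) (y, U) = ½ (U x - T y, ψ x y)`. -/
def YagzhevEnvelope (_ψ : B →ₗ[k] B →ₗ[k] B →ₗ[k] B) : Type v := B × (B →ₗ[k] B)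

namespace YagzhevEnvelope

variable (ψ : B →ₗ[k] B →ₗ[k] B →ₗ[k] B)

instance : AddCommGroup (YagzhevEnvelope ψ) := inferInstanceAs (AddCommGroup (B × (B →ₗ[k] B)))

instance : Module k (YagzhevEnvelope ψ) := inferInstanceAs (Module k (B × (B →ₗ[k] B)))

instance : Mul (YagzhevEnvelope ψ) :=
  ⟨fun a b => ((2⁻¹ : k) • (b.2 a.1 - a.2 b.1), (2⁻¹ : k) • ψ a.1 b.1)⟩

variable {ψ}

@[ext]
theorem ext {a b : YagzhevEnvelope ψ} (h₁ : a.1 = b.1) (h₂ : a.2 = b.2) : a = b := Prod.ext h₁ h₂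

@[simp] theorem fst_zero : (0 : YagzhevEnvelope ψ).1 = 0 := rfl
@[simp] theorem snd_zero : (0 : YagzhevEnvelope ψ).2 = 0 := rfl
@[simp] theorem fst_add (a b : YagzhevEnvelope ψ) : (a + b).1 = a.1 + b.1 := rfl
@[simp] theorem snd_add (a b : YagzhevEnvelope ψ) : (a + b).2 = a.2 + b.2 := rfl
@[simp] theorem fst_neg (a : YagzhevEnvelope ψ) : (-a).1 = -a.1 := rfl
@[simp] theorem snd_neg (a : YagzhevEnvelope ψ) : (-a).2 = -a.2 := rfl
@[simp] theorem fst_smul (c : k) (a : YagzhevEnvelope ψ) : (c • a).1 = c • a.1 := rfl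
@[simp] theorem snd_smul (c : k) (a : YagzhevEnvelope ψ) : (c • a).2 = c • a.2 := rfl

@[simp]
theorem fst_mul (a b : YagzhevEnvelope ψ) : (a * b).1 = (2⁻¹ : k) • (b.2 a.1 - a.2 b.1) := rfl

@[simp]
theorem snd_mul (a b : YagzhevEnvelope ψ) : (a * b).2 = (2⁻¹ : k) • ψ a.1 b.1 := rfl

instance : NonUnitalNonAssocRing (YagzhevEnvelope ψ) where
  left_distrib a b c := by
    ext
    · simp; module
    · simp
  right_distrib a b c := by
    ext
    · simp; module
    · simp
  zero_mul a := by ext <;> simp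
  mul_zero a := by ext <;> simp

@[simp] theorem fst_sub (a b : YagzhevEnvelope ψ) : (a - b).1 = a.1 - b.1 := rfl
@[simp] theorem snd_sub (a b : YagzhevEnvelope ψ) : (a - b).2 = a.2 - b.2 := rfl

instance : IsScalarTower k (YagzhevEnvelope ψ) (YagzhevEnvelope ψ) where
  smul_assoc c a b := by ext <;> simp <;> module

instance : SMulCommClass k (YagzhevEnvelope ψ) (YagzhevEnvelope ψ) where
  smul_comm c a b := by ext <;> simp <;> module

variable (ψ) in
/-- The inclusion of `B` in its envelope. -/
def inl : B →ₗ[k] YagzhevEnvelope ψ := LinearMap.inl k B (B →ₗ[k] B)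

variable (ψ) in
theorem inl_injective : Function.Injective (inl ψ) := LinearMap.inl_injective

@[simp] theorem fst_inl (b : B) : (inl ψ b).1 = b := rfl
@[simp] theorem snd_inl (b : B) : (inl ψ b).2 = 0 := rfl

/-- The first component of the product is antisymmetric and the second symmetric, so `a ∘ b = (0, ψ
a.1 b.1)`. Elements `(0, V)` anticommute with everything, which gives the first identity; both sides
of the second are `(-½ ψ(a, b, b), 0)`. -/
theorem isYagzhev (hψ : TotallyCommutative fun x y z => ψ x y z) :
    IsYagzhev (YagzhevEnvelope ψ) where
  mul_sq a b := by
    ext <;> simp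
  anticomm_mul a b := by
    have h₁ : ψ b.1 a.1 = ψ a.1 b.1 := LinearMap.ext fun z => hψ.swap_left _ _ _
    have h₂ : ψ a.1 b.1 b.1 = ψ b.1 b.1 a.1 := (hψ.swap_left _ _ _).trans (hψ.swap_right _ _ _)
    ext <;> simp [two_smul, h₁, h₂] <;> module

/-- On `B` the commutator of `x` with `y ∘ z = (0, ψ y z)` is `½ ψ(y, z, x)` taken twice; this fixes
the factor `½` in the product. -/
theorem phi_inl [CharZero k] (hψ : TotallyCommutative fun x y z => ψ x y z) (x y z : B) :
    yagzhevPhi (inl ψ x) (inl ψ y) (inl ψ z) = inl ψ (ψ x y z) := by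
  have h₁ : ψ z y x = ψ x y z :=
    ((hψ.swap_left _ _ _).trans (hψ.swap_right _ _ _)).trans (hψ.swap_left _ _ _)
  have h₂ : ψ y z x = ψ x y z := (hψ.swap_right _ _ _).trans (hψ.swap_left _ _ _)
  ext <;> simp [yagzhevPhi, h₁, h₂]
  module

theorem eval_phi_inl [CharZero k] (hψ : TotallyCommutative fun x y z => ψ x y z)
    {X : Type w} (b : X → B) (t : TernaryTerm X) :
    t.eval yagzhevPhi (fun x => inl ψ (b x)) = inl ψ (t.eval (fun x y z => ψ x y z) b) := by
  induction t with
  | var x => rfl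
  | op s t r hs ht hr => simp only [TernaryTerm.eval, hs, ht, hr, phi_inl hψ]

end YagzhevEnvelope

end Envelope

/-! ### The free totally commutative ternary algebra -/

section FreeTernary

variable (X : Type v)

/-- The setoid on terms given by equality up to total commutativity. -/
def TernaryTerm.commSetoid : Setoid (TernaryTerm X) where
  r := TernaryTerm.CommRel
  iseqv := ⟨.refl, .symm, .trans⟩

/-- Terms up to total commutativity. -/
def CommTernaryTerm : Type v := Quotient (TernaryTerm.commSetoid X)

variable {X}

/-- The class of a term. -/
def CommTernaryTerm.mk (t : TernaryTerm X) : CommTernaryTerm X :=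
  Quotient.mk (TernaryTerm.commSetoid X) t

/-- The ternary operation on classes of terms. -/
def CommTernaryTerm.op (a b c : CommTernaryTerm X) : CommTernaryTerm X :=
  Quotient.liftOn₂ a b
    (fun a b => Quotient.liftOn c (fun c => mk (.op a b c))
      fun _ _ h => Quotient.sound (.congr (.refl _) (.refl _) h))
    fun _ _ _ _ h₁ h₂ =>
      Quotient.inductionOn c fun _ => Quotient.sound (.congr h₁ h₂ (.refl _))

theorem CommTernaryTerm.op_swap_left (a b c : CommTernaryTerm X) : op a b c = op b a c :=
  Quotient.inductionOn₃ a b c fun _ _ _ => Quotient.sound (.swap₁₂ _ _ _)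

theorem CommTernaryTerm.op_swap_right (a b c : CommTernaryTerm X) : op a b c = op a c b :=
  Quotient.inductionOn₃ a b c fun _ _ _ => Quotient.sound (.swap₂₃ _ _ _)

end FreeTernary

section FreeTernaryAlgebra

variable (k : Type u) [Field k] (X : Type v)

/-- The trilinear operation of the free totally commutative ternary algebra. -/
noncomputable def freeTernaryOp : (CommTernaryTerm X →₀ k) →ₗ[k] (CommTernaryTerm X →₀ k) →ₗ[k]
    (CommTernaryTerm X →₀ k) →ₗ[k] (CommTernaryTerm X →₀ k) :=
  Finsupp.linearCombination k fun a => Finsupp.linearCombination k fun b =>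
    Finsupp.linearCombination k fun c => Finsupp.single (CommTernaryTerm.op a b c) 1

variable {k X}

theorem freeTernaryOp_single (a b c : CommTernaryTerm X) :
    freeTernaryOp k X (.single a 1) (.single b 1) (.single c 1) = .single (.op a b c) 1 := by
  simp [freeTernaryOp]

theorem totallyCommutative_freeTernaryOp :
    TotallyCommutative fun x y z => freeTernaryOp k X x y z := by
  have h₁ : freeTernaryOp k X = (freeTernaryOp k X).flip := by
    -- Depth 6 reduces the three arguments to basis vectors and stops before coefficients are
    -- compared.
    ext a b c : 6
    simp [freeTernaryOp_single, CommTernaryTerm.op_swap_left a b c]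
  have h₂ : freeTernaryOp k X = LinearMap.lflip.comp (freeTernaryOp k X) := by
    ext a b c : 6
    simp [freeTernaryOp_single, CommTernaryTerm.op_swap_right a b c]
  refine totallyCommutative_of_swap (fun a b c => ?_) (fun a b c => ?_)
  · exact congrArg (fun f => f a b c) h₁
  · exact congrArg (fun f => f a b c) h₂

theorem eval_freeTernaryOp (t : TernaryTerm X) :
    t.eval (fun x y z => freeTernaryOp k X x y z) (fun x => .single (.mk (.var x)) 1) =
      .single (.mk t) 1 := by
  induction t with
  | var x => rfl
  | op s t r hs ht hr =>
    simp only [TernaryTerm.eval, hs, ht, hr, freeTernaryOp_single]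
    rfl

theorem eval_phi_freeTernaryOp [CharZero k] (t : TernaryTerm X) :
    t.eval yagzhevPhi (fun x => YagzhevEnvelope.inl (freeTernaryOp k X) (.single (.mk (.var x)) 1)) =
      YagzhevEnvelope.inl (freeTernaryOp k X) (.single (.mk t) 1) := by
  rw [YagzhevEnvelope.eval_phi_inl (ψ := freeTernaryOp k X) totallyCommutative_freeTernaryOp
    (fun x => .single (.mk (.var x)) 1) t, eval_freeTernaryOp]

end FreeTernaryAlgebra

/-- An identity of `φ` in the envelope of the free totally commutative ternary algebra holds for
every totally commutative ternary operation. -/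
theorem satisfiesTernaryIdentity_of_yagzhev {k : Type u} [Field k] [CharZero k] {X : Type v}
    (p : TernaryTerm X →₀ k)
    (hp : SatisfiesTernaryIdentity
      (yagzhevPhi : YagzhevEnvelope (freeTernaryOp k X) → _ → _ → _) p)
    {B : Type w} [AddCommGroup B] [Module k B] {op : B → B → B → B} (hop : TotallyCommutative op) :
    SatisfiesTernaryIdentity op p := by
  -- Evaluating `p` at the generators reads off its coefficients summed over each class of terms.
  have h₀ : p.mapDomain CommTernaryTerm.mk = 0 := by
    have h := hp fun x => .inl _ (.single (.mk (.var x)) 1)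
    simp only [eval_phi_freeTernaryOp, ← map_smul] at h
    rw [← map_finsuppSum] at h
    have h := YagzhevEnvelope.inl_injective _ (h.trans (map_zero _).symm)
    rw [← h, Finsupp.mapDomain]
    simp only [Finsupp.smul_single, smul_eq_mul, mul_one]
  intro a
  let ev : CommTernaryTerm X → B :=
    Quotient.lift (fun t => t.eval op a) fun _ _ h => hop.eval_eq_of_commRel a h
  have h : Finsupp.linearCombination k ev (p.mapDomain CommTernaryTerm.mk) =
      p.sum fun t c => c • t.eval op a := by
    rw [Finsupp.linearCombination_mapDomain]; rfl
  rw [← h, h₀, map_zero]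

/-! ### The suboperad generated by `φ` -/

section Suboperad

theorem map_yagzhevPhi {A : Type v} {A' : Type w} [NonUnitalNonAssocRing A]
    [NonUnitalNonAssocRing A'] {F : Type*} [FunLike F A A'] [AddMonoidHomClass F A A']
    [MulHomClass F A A'] (f : F) (x y z : A) :
    f (yagzhevPhi x y z) = yagzhevPhi (f x) (f y) (f z) := by
  simp only [yagzhevPhi, map_sub, map_mul, map_add]

theorem map_eval_yagzhevPhi {A : Type v} {A' : Type w} [NonUnitalNonAssocRing A]
    [NonUnitalNonAssocRing A'] {F : Type*} [FunLike F A A'] [AddMonoidHomClass F A A']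
    [MulHomClass F A A'] (f : F) {X : Type*} (a : X → A) (t : TernaryTerm X) :
    f (t.eval yagzhevPhi a) = t.eval yagzhevPhi (fun x => f (a x)) := by
  induction t with
  | var x => rfl
  | op s t r hs ht hr => simp only [TernaryTerm.eval, map_yagzhevPhi, hs, ht, hr]

variable {k : Type u} [Field k]

theorem FreeYagzhev.subst_of {X : Type v} {Y : Type w} (f : X → FreeYagzhev k Y) (x : X) :
    subst f (.of k x) = f x := lift_of _ _ _

theorem FreeYagzhev.subst_subst {X Y Z : Type*} (f : X → FreeYagzhev k Y)
    (g : Y → FreeYagzhev k Z) (p : FreeYagzhev k X) :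
    subst g (subst f p) = subst (fun x => subst g (f x)) p := by
  have h : (subst g).comp (subst f) = subst (fun x => subst g (f x)) :=
    lift_unique _ _ _ fun x => by
      rw [NonUnitalAlgHom.comp_apply, subst_of]
  exact DFunLike.congr_fun h p

/-- Every term without repeated variables comes from an operation generated by `φ`. -/
theorem exists_isPhiOperation_of_nodup {X : Type} (t : TernaryTerm X) (ht : t.leaves.Nodup) :
    ∃ (T : Type) (_ : Finite T) (g : T → X) (p : FreeYagzhev k T),
      Function.Injective g ∧ (∀ x, x ∈ t.leaves ↔ ∃ i, g i = x) ∧ IsPhiOperation k T p ∧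
        FreeYagzhev.subst (fun i => .of k (g i)) p = t.eval yagzhevPhi (.of k) := by
  induction t with
  | var x =>
    refine ⟨Unit, inferInstance, fun _ => x, _, fun _ _ _ => rfl, fun y => ?_, .id, ?_⟩
    · simp [TernaryTerm.leaves, eq_comm]
    · rw [FreeYagzhev.subst_of]; rfl
  | op a b c ha hb hc =>
    simp only [TernaryTerm.leaves, List.nodup_append, List.mem_append] at ht
    obtain ⟨⟨ha', hb', hab⟩, hc', hc''⟩ := ht
    let u : Fin 3 → TernaryTerm X := ![a, b, c]
    have hu : ∀ i, ∃ (T : Type) (_ : Finite T) (g : T → X) (p : FreeYagzhev k T),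
        Function.Injective g ∧ (∀ x, x ∈ (u i).leaves ↔ ∃ i, g i = x) ∧ IsPhiOperation k T p ∧
          FreeYagzhev.subst (fun i => .of k (g i)) p = (u i).eval yagzhevPhi (.of k) := by
      intro i
      fin_cases i
      exacts [ha ha', hb hb', hc hc']
    -- Disjoint leaf sets make the map from the disjoint union of the inputs to `X` injective.
    have hdisj : ∀ i j x, x ∈ (u i).leaves → x ∈ (u j).leaves → i = j := by
      intro i j x
      fin_cases i <;> fin_cases j <;> simp [u] <;> grind
    choose T hT g q hg hmem hq heq using hu
    refine ⟨Σ i, T i, inferInstance, fun i => g i.1 i.2, _, ?_, ?_, .comp _ q .phi hq, ?_⟩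
    · rintro ⟨i, x⟩ ⟨j, y⟩ h
      obtain rfl : i = j := hdisj i j (g i x) ((hmem i _).2 ⟨x, rfl⟩) ((hmem j _).2 ⟨y, h.symm⟩)
      exact congrArg _ (hg i h)
    · intro x
      have : x ∈ (TernaryTerm.op a b c).leaves ↔ ∃ i, x ∈ (u i).leaves := by
        simp [TernaryTerm.leaves, Fin.exists_fin_succ, u]
      rw [this, Sigma.exists]
      exact exists_congr fun i => hmem i x
    · simp only [FreeYagzhev.subst_subst, map_yagzhevPhi, FreeYagzhev.subst_of, heq]
      rfl

theorem isPhiOperation_eval {S : Type} (t : TernaryTerm S) (ht : t.IsMultilinear) :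
    IsPhiOperation k S (t.eval yagzhevPhi (.of k)) := by
  obtain ⟨T, _, g, p, hg, hmem, hp, h⟩ := exists_isPhiOperation_of_nodup (k := k) t ht.1
  rw [← h]
  exact hp.rename (Equiv.ofBijective g ⟨hg, fun x => (hmem x).1 (ht.2 x)⟩)

/-- The span of the values at `φ` of the terms in which each element of `s` occurs exactly once,
and no other variables occur. -/
noncomputable def phiSpan (k : Type u) [Field k] {X : Type v} (s : Set X) : Submodule k (FreeYagzhev k X) :=
  Submodule.span k {p | ∃ t : TernaryTerm X, t.leaves.Nodup ∧ (∀ x, x ∈ t.leaves ↔ x ∈ s) ∧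
    t.eval yagzhevPhi (.of k) = p}

theorem yagzhevPhi_mem_phiSpan {X : Type v} {s₁ s₂ s₃ s : Set X} (h₁₂ : Disjoint s₁ s₂)
    (h₁₃ : Disjoint s₁ s₃) (h₂₃ : Disjoint s₂ s₃) (hs : s = s₁ ∪ s₂ ∪ s₃)
    {x y z : FreeYagzhev k X} (hx : x ∈ phiSpan k s₁) (hy : y ∈ phiSpan k s₂)
    (hz : z ∈ phiSpan k s₃) : yagzhevPhi x y z ∈ phiSpan k s := by
  -- Bundled as a trilinear map, `φ` allows span induction in each argument in turn.
  let φ : FreeYagzhev k X →ₗ[k] FreeYagzhev k X →ₗ[k] FreeYagzhev k X →ₗ[k] FreeYagzhev k X :=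
    LinearMap.mk₂ k (fun x y =>
      { toFun := yagzhevPhi x y
        map_add' := fun z z' => by simp only [yagzhevPhi, mul_add, add_mul]; abel
        map_smul' := fun c z => by
          simp only [yagzhevPhi, smul_mul_assoc, mul_smul_comm, ← smul_add, ← smul_sub,
            RingHom.id_apply] })
      (fun x x' y => LinearMap.ext fun z => by
        change yagzhevPhi (x + x') y z = yagzhevPhi x y z + yagzhevPhi x' y z
        simp only [yagzhevPhi, mul_add, add_mul]; abel)
      (fun c x y => LinearMap.ext fun z => by
        change yagzhevPhi (c • x) y z = c • yagzhevPhi x y z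
        simp only [yagzhevPhi, smul_mul_assoc, mul_smul_comm, ← smul_sub])
      (fun x y y' => LinearMap.ext fun z => by
        change yagzhevPhi x (y + y') z = yagzhevPhi x y z + yagzhevPhi x y' z
        simp only [yagzhevPhi, mul_add, add_mul]; abel)
      (fun c x y => LinearMap.ext fun z => by
        change yagzhevPhi x (c • y) z = c • yagzhevPhi x y z
        simp only [yagzhevPhi, smul_mul_assoc, mul_smul_comm, ← smul_add, ← smul_sub])
  change φ x y z ∈ _
  induction hx using Submodule.span_induction with
  | zero => simp
  | add x x' _ _ h h' => simpa using add_mem h h'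
  | smul c x _ h => simpa using Submodule.smul_mem _ c h
  | mem x hx =>
  induction hy using Submodule.span_induction with
  | zero => simp
  | add x x' _ _ h h' => simpa using add_mem h h'
  | smul c x _ h => simpa using Submodule.smul_mem _ c h
  | mem y hy =>
  induction hz using Submodule.span_induction with
  | zero => simp
  | add x x' _ _ h h' => simpa using add_mem h h'
  | smul c x _ h => simpa using Submodule.smul_mem _ c h
  | mem z hz =>
  obtain ⟨a, ha, ha', rfl⟩ := hx
  obtain ⟨b, hb, hb', rfl⟩ := hy
  obtain ⟨c, hc, hc', rfl⟩ := hz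
  refine Submodule.subset_span ⟨.op a b c, ?_, fun x => ?_, rfl⟩
  · rw [Set.disjoint_left] at *
    simp only [TernaryTerm.leaves, List.nodup_append, List.mem_append, ha, hb, hc, ha', hb', hc']
    grind
  · simp [TernaryTerm.leaves, ha', hb', hc', hs, or_assoc]

/-- The map `r` sends each new variable to the input whose substituted operation contains it;
distinct inputs have disjoint fibres, so no variable is repeated. -/
theorem eval_mem_phiSpan {X : Type v} {Y : Type w} (r : Y → X) (f : X → FreeYagzhev k Y)
    (hf : ∀ x, f x ∈ phiSpan k (r ⁻¹' {x})) (t : TernaryTerm X) (ht : t.leaves.Nodup) :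
    t.eval yagzhevPhi f ∈ phiSpan k {y | r y ∈ t.leaves} := by
  induction t with
  | var x =>
    have h : {y | r y ∈ (TernaryTerm.var x).leaves} = r ⁻¹' {x} := by
      ext y; simp [TernaryTerm.leaves]
    rw [h]
    exact hf x
  | op a b c ha hb hc =>
    simp only [TernaryTerm.leaves, List.nodup_append, List.mem_append] at ht
    obtain ⟨⟨ha', hb', hab⟩, hc', hc''⟩ := ht
    refine yagzhevPhi_mem_phiSpan ?_ ?_ ?_ ?_ (ha ha') (hb hb') (hc hc')
    · exact Set.disjoint_left.2 fun y h h' => hab _ h _ h' rfl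
    · exact Set.disjoint_left.2 fun y h h' => hc'' _ (.inl h) _ h' rfl
    · exact Set.disjoint_left.2 fun y h h' => hc'' _ (.inr h) _ h' rfl
    · ext y; simp [TernaryTerm.leaves, or_assoc]

theorem subst_mem_phiSpan {X : Type v} {Y : Type w} (r : Y → X) (f : X → FreeYagzhev k Y)
    (hf : ∀ x, f x ∈ phiSpan k (r ⁻¹' {x})) {p : FreeYagzhev k X} {s : Set X}
    (hp : p ∈ phiSpan k s) : FreeYagzhev.subst f p ∈ phiSpan k (r ⁻¹' s) := by
  induction hp using Submodule.span_induction with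
  | zero => simp
  | add x x' _ _ h h' => simpa using add_mem h h'
  | smul c x _ h => simpa using Submodule.smul_mem _ c h
  | mem p hp =>
    obtain ⟨t, ht, hts, rfl⟩ := hp
    rw [map_eval_yagzhevPhi]
    simp only [FreeYagzhev.subst_of]
    convert eval_mem_phiSpan r f hf t ht using 2
    ext y; simp [hts]

theorem of_mem_phiSpan {X : Type v} (x : X) : FreeYagzhev.of k x ∈ phiSpan k {x} :=
  Submodule.subset_span ⟨.var x, by simp [TernaryTerm.leaves], by simp [TernaryTerm.leaves], rfl⟩

/-- Needed for bijective renaming and for placing an operation in one summand of a disjoint union of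
inputs. -/
theorem map_mem_phiSpan {X : Type v} {Y : Type w} {g : X → Y} (hg : Function.Injective g)
    {p : FreeYagzhev k X} {s : Set X} (hp : p ∈ phiSpan k s) :
    FreeYagzhev.subst (fun x => .of k (g x)) p ∈ phiSpan k (g '' s) := by
  induction hp using Submodule.span_induction with
  | zero => simp
  | add x x' _ _ h h' => simpa using add_mem h h'
  | smul c x _ h => simpa using Submodule.smul_mem _ c h
  | mem p hp =>
    obtain ⟨t, ht, hts, rfl⟩ := hp
    rw [map_eval_yagzhevPhi]
    simp only [FreeYagzhev.subst_of]
    -- With `s` expressed through `t`, the set shrinks along with the term in the induction.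
    have hs : s = {x | x ∈ t.leaves} := by ext; simp [hts]
    subst hs
    clear hts
    induction t with
    | var x => simpa [TernaryTerm.leaves, TernaryTerm.eval] using of_mem_phiSpan (g x)
    | op a b c ha hb hc =>
      simp only [TernaryTerm.leaves, List.nodup_append, List.mem_append] at ht
      obtain ⟨⟨ha', hb', hab⟩, hc', hc''⟩ := ht
      refine yagzhevPhi_mem_phiSpan ?_ ?_ ?_ ?_ (ha ha') (hb hb') (hc hc')
      · exact (Set.disjoint_image_iff hg).2 <| Set.disjoint_left.2 fun y h h' => hab _ h _ h' rfl
      · exact (Set.disjoint_image_iff hg).2 <|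
          Set.disjoint_left.2 fun y h h' => hc'' _ (.inl h) _ h' rfl
      · exact (Set.disjoint_image_iff hg).2 <|
          Set.disjoint_left.2 fun y h h' => hc'' _ (.inr h) _ h' rfl
      · rw [← Set.image_union, ← Set.image_union]
        congr 1; ext y; simp [TernaryTerm.leaves, or_assoc]

theorem IsPhiOperation.mem_phiSpan {S : Type} {p : FreeYagzhev k S} (hp : IsPhiOperation k S p) :
    p ∈ phiSpan k Set.univ := by
  induction hp with
  | id =>
    convert of_mem_phiSpan () using 2
    ext; simp
  | phi =>
    refine Submodule.subset_span ⟨.op (.var 0) (.var 1) (.var 2), ?_, ?_, rfl⟩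
    · simp [TernaryTerm.leaves]
    · intro x; fin_cases x <;> simp [TernaryTerm.leaves]
  | rename e p _ h =>
    have h' := map_mem_phiSpan e.injective h
    rwa [Set.image_univ, e.surjective.range_eq] at h'
  | @comp S _ F _ p q _ _ hp hq =>
    have hf : ∀ s, FreeYagzhev.subst (fun i => .of k ⟨s, i⟩) (q s) ∈
        phiSpan k ((Sigma.fst : (Σ s, F s) → S) ⁻¹' {s}) := fun s => by
      rw [← Set.range_sigmaMk, ← Set.image_univ]
      exact map_mem_phiSpan sigma_mk_injective (hq s)
    have h := subst_mem_phiSpan _ _ hf hp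
    rwa [Set.preimage_univ] at h
  | zero => exact zero_mem _
  | add p q _ _ hp hq => exact add_mem hp hq
  | smul c p _ h => exact Submodule.smul_mem _ c h

/-! ### The basis of trees -/

variable (k) [CharZero k] (S : Type)

/-- The value of a tree at `φ`. -/
noncomputable def TernaryTree.evalPhi (t : TernaryTree S) : FreeYagzhev k S :=
  Quotient.lift (fun t => t.1.eval yagzhevPhi (.of k))
    (fun _ _ h => (FreeYagzhev.isYagzhev.totallyCommutative_phi k).eval_eq_of_commRel _ h) t

/-- The homomorphism `L` to the envelope of the free ternary algebra carries different trees to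
different basis vectors of that algebra. -/
theorem linearIndependent_evalPhi : LinearIndependent k (TernaryTree.evalPhi k S) := by
  let L := FreeYagzhev.lift (k := k) (X := S)
    (YagzhevEnvelope.isYagzhev (totallyCommutative_freeTernaryOp (k := k) (X := S)))
    fun s => .inl _ (.single (.mk (.var s)) 1)
  let c : TernaryTree S → CommTernaryTerm S :=
    Quotient.lift (fun t => .mk t.1) fun _ _ h => Quotient.sound h
  have hc : Function.Injective c := by
    rintro ⟨s⟩ ⟨t⟩ h
    exact Quotient.sound (Quotient.exact h :)
  have hL : ∀ t, L (TernaryTree.evalPhi k S t) = .inl _ (.single (c t) 1) := by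
    rintro ⟨t⟩
    change L (t.1.eval yagzhevPhi (.of k)) = .inl _ (.single (.mk t.1) 1)
    rw [map_eval_yagzhevPhi]
    simp only [L, FreeYagzhev.lift_of, eval_phi_freeTernaryOp]
  refine LinearIndependent.of_comp (LinearMapClass.linearMap L) ?_
  have h := ((Finsupp.basisSingleOne (R := k) (ι := CommTernaryTerm S)).linearIndependent.comp c
    hc).map' (YagzhevEnvelope.inl (freeTernaryOp k S))
      (LinearMap.ker_eq_bot.2 (YagzhevEnvelope.inl_injective _))
  have e : YagzhevEnvelope.inl (freeTernaryOp k S) ∘ Finsupp.basisSingleOne ∘ c =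
      LinearMapClass.linearMap (R := k) L ∘ TernaryTree.evalPhi k S :=
    funext fun t => by simpa using (hL t).symm
  rw [e] at h
  exact h

theorem span_range_evalPhi :
    Submodule.span k (Set.range (TernaryTree.evalPhi k S)) = phiSuboperad k S := by
  refine le_antisymm (Submodule.span_le.2 ?_) fun p hp => ?_
  · rintro _ ⟨⟨t⟩, rfl⟩
    exact isPhiOperation_eval t.1 t.2
  · refine Submodule.span_mono ?_ (IsPhiOperation.mem_phiSpan hp)
    rintro _ ⟨t, ht, hts, rfl⟩
    exact ⟨.mk t ⟨ht, fun x => (hts x).2 trivial⟩, rfl⟩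

/-- The component with inputs `S` of the suboperad generated by `φ` has the trees as a basis. -/
noncomputable def freeCommTernaryOperadEquiv : FreeCommTernaryOperad k S ≃ₗ[k] phiSuboperad k S :=
  (linearIndependent_evalPhi k S).linearCombinationEquiv.trans
    (LinearEquiv.ofEq _ _ (span_range_evalPhi k S))

theorem freeCommTernaryOperadEquiv_single (t : TernaryTerm S) (ht : t.IsMultilinear) :
    (freeCommTernaryOperadEquiv k S (Finsupp.single (TernaryTree.mk t ht) 1) : FreeYagzhev k S) =
      t.eval yagzhevPhi (.of k) := by
  simp [freeCommTernaryOperadEquiv]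
  rfl

end Suboperad

theorem mainTheorem8 (k : Type u) [Field k] [CharZero k] :
    -- the operation `φ` is totally commutative, and Yagzhev's iterated identity is the Engel one
    (∀ (A : Type v) [NonUnitalNonAssocRing A] [Module k A] [IsScalarTower k A A]
        [SMulCommClass k A A], IsYagzhev A →
      TotallyCommutative (yagzhevPhi : A → A → A → A) ∧
      ∀ (n : ℕ) (x y : A),
        (fun z => z * (y * y))^[n] x = 0 ↔ (fun z => yagzhevPhi z y y)^[n] x = 0) ∧
    -- every identity of `φ` follows from total commutativity
    (∀ p : TernaryTerm ℕ →₀ k,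
      (∀ (A : Type u) [NonUnitalNonAssocRing A] [Module k A] [IsScalarTower k A A]
        [SMulCommClass k A A], IsYagzhev A →
          SatisfiesTernaryIdentity (yagzhevPhi : A → A → A → A) p) →
      ∀ (B : Type w) [AddCommGroup B] [Module k B] (ψ : B →ₗ[k] B →ₗ[k] B →ₗ[k] B),
        TotallyCommutative (fun x y z => ψ x y z) →
          SatisfiesTernaryIdentity (fun x y z => ψ x y z) p) ∧
    -- the suboperad generated by `φ` is free: it is identified with the free operad on one totally
    -- commutative ternary operation by evaluating tree monomials at `φ`
    (∀ (S : Type) [Finite S],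
      ∃ e : FreeCommTernaryOperad k S ≃ₗ[k] phiSuboperad k S,
        ∀ (t : TernaryTerm S) (ht : t.IsMultilinear),
          (e (Finsupp.single (TernaryTree.mk t ht) 1) : FreeYagzhev k S) =
            t.eval yagzhevPhi (FreeYagzhev.of k)) := by
  refine ⟨fun A _ _ _ _ hA => ⟨hA.totallyCommutative_phi k, hA.iterate_mul_sq_eq_zero_iff k⟩,
    fun p hp B _ _ ψ hψ => ?_, fun S _ =>
      ⟨freeCommTernaryOperadEquiv k S, freeCommTernaryOperadEquiv_single k S⟩⟩
  exact satisfiesTernaryIdentity_of_yagzhev p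
    -- With countably many variables this envelope lies in the universe of `k`, so it is among the
    -- algebras tested by `hp`.
    (hp _ (YagzhevEnvelope.isYagzhev totallyCommutative_freeTernaryOp)) hψ
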